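/- Let $G$ be a finite connected simple graph with edge weights $w(e)\ge 0$. Write $d_G(u,v)$ for the weighted shortest-path distance, $w(H)$ for the total edge weight of a subgraph $H$, and $\mathrm{MST}(G)$ for the minimum weight of a spanning tree of $G$. For $\varepsilon>0$, a $(1+\varepsilon)$-spanner of $G$ is a spanning subgraph $H$ with $d_H(u,v)\le(1+\varepsilon)\,d_G(u,v)$ for all vertices $u,v$. A caterpillar is a tree containing a path such that every vertex is on the path or adjacent to a vertex of it. The catwidth of $G$ is the least $k$ such that $G$ has a tree decomposition whose tree is a caterpillar and whose bags have at most $k+1$ vertices. For a spanning tree $T$ of $G$, the greedy algorithm starts with $G'=T$, goes through the edges $e=uv$ of $G$ not in $T$ in an order of non-decreasing weight, and adds $e$ to $G'$ whenever $(1+\varepsilon)\,w(e)<d_{G'}(u,v)$ for the current $G'$. Theorem. Graphs of bounded catwidth have light spanners, computable by a greedy algorithm. Precisely: there is an absolute constant $C$ such that for every finite connected graph $G$ of catwidth at most $k$, all edge weights $w\ge0$ and every $\varepsilon>0$, the graph $G$ has a $(1+\varepsilon)$-spanner of weight at most $$C\,k^2\left(1+\frac{k}{\varepsilon}\right)\mathrm{MST}(G),$$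 which is $O(k^3/\varepsilon)\cdot\mathrm{MST}(G)$ for $0<\varepsilon\le k$. Moreover, for every minimum spanning tree $T$ of $G$ and every non-decreasing order of the remaining edges (ties broken arbitrarily), the greedy algorithm outputs such a spanner. -/

import Mathlib

open scoped NNReal ENNReal

universe u

/-- A caterpillar: a tree with a central path such that every vertex lies on the path or is
adjacent to a vertex of the path. -/
def IsCaterpillar {ι : Type*} (S : SimpleGraph ι) : Prop :=
  S.IsTree ∧ ∃ (a b : ι) (p : S.Walk a b), p.IsPath ∧
    ∀ i, i ∈ p.support ∨ ∃ j ∈ p.support, S.Adj i j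

/-- `(S, B)` satisfies the bag conditions of a tree decomposition of `G`. -/
structure IsTreeDecomposition {V ι : Type*} (G : SimpleGraph V) (S : SimpleGraph ι)
    (B : ι → Finset V) : Prop where
  isTree : S.IsTree
  vertex_mem : ∀ v, ∃ i, v ∈ B i
  edge_mem : ∀ u v, G.Adj u v → ∃ i, u ∈ B i ∧ v ∈ B i
  connected : ∀ v, (S.induce {i | v ∈ B i}).Preconnected

/-- `G` has a caterpillar decomposition of width at most `k`. -/
def HasCaterpillarDecomposition {V : Type*} (G : SimpleGraph V) (k : ℕ) : Prop :=
  ∃ (n : ℕ) (S : SimpleGraph (Fin n)) (B : Fin n → Finset V),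
    IsCaterpillar S ∧ IsTreeDecomposition G S B ∧ ∀ i, (B i).card ≤ k + 1

/-- The catwidth: the minimum width of a caterpillar decomposition. -/
noncomputable def catwidth {V : Type*} (G : SimpleGraph V) : ℕ :=
  sInf {k | HasCaterpillarDecomposition G k}

/-- The length of a walk with respect to the edge weights `w`. -/
def walkWeight {V : Type*} (w : Sym2 V → ℝ≥0) {G : SimpleGraph V} {u v : V}
    (p : G.Walk u v) : ℝ≥0 :=
  (p.edges.map w).sum

/-- The weighted shortest path distance (infinite between different components). -/
noncomputable def weightedDist {V : Type*} (w : Sym2 V → ℝ≥0) (G : SimpleGraph V)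
    (u v : V) : ℝ≥0∞ :=
  ⨅ p : G.Walk u v, (walkWeight w p : ℝ≥0∞)

theorem weightedDist_comm {V : Type*} (w : Sym2 V → ℝ≥0) (G : SimpleGraph V) (u v : V) :
    weightedDist w G u v = weightedDist w G v u := by
  have key : ∀ a b : V, weightedDist w G a b ≤ weightedDist w G b a := by
    intro a b
    refine le_iInf fun p => (iInf_le _ p.reverse).trans (le_of_eq ?_)
    simp [walkWeight, SimpleGraph.Walk.edges_reverse, List.map_reverse, List.sum_reverse]
  exact le_antisymm (key u v) (key v u)

/-- The weighted distance between the two ends of an unordered pair. -/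
noncomputable def edgeDist {V : Type*} (w : Sym2 V → ℝ≥0) (G : SimpleGraph V) :
    Sym2 V → ℝ≥0∞ :=
  Sym2.lift ⟨weightedDist w G, weightedDist_comm w G⟩

open Classical in
/-- The total weight of the edges of `G`. -/
noncomputable def totalWeight {V : Type*} [Fintype V] (w : Sym2 V → ℝ≥0)
    (G : SimpleGraph V) : ℝ≥0 :=
  ∑ e ∈ G.edgeFinset, w e

/-- `T` is a spanning tree of `G`. -/
def IsSpanningTree {V : Type*} (G T : SimpleGraph V) : Prop :=
  T ≤ G ∧ T.IsTree

/-- `MST(G)`: the minimum weight of a spanning tree of `G`. -/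
noncomputable def mstWeight {V : Type*} [Fintype V] (w : Sym2 V → ℝ≥0)
    (G : SimpleGraph V) : ℝ≥0 :=
  sInf {x | ∃ T, IsSpanningTree G T ∧ totalWeight w T = x}

/-- `T` is a minimum weight spanning tree of `G`. -/
def IsMinSpanningTree {V : Type*} [Fintype V] (w : Sym2 V → ℝ≥0)
    (G T : SimpleGraph V) : Prop :=
  IsSpanningTree G T ∧ ∀ T', IsSpanningTree G T' → totalWeight w T ≤ totalWeight w T'

/-- `H` is a `(1+ε)`-spanner of `G`: a spanning subgraph stretching distances by at most
the factor `1+ε`. -/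
def IsSpanner {V : Type*} (w : Sym2 V → ℝ≥0) (ε : ℝ≥0) (G H : SimpleGraph V) : Prop :=
  H ≤ G ∧ ∀ u v, weightedDist w H u v ≤ (1 + ε) * weightedDist w G u v

open Classical in
/-- One step of the greedy algorithm: add the edge `e` to the current graph `H` if
`(1+ε) w(e) < d_H(e)`. -/
noncomputable def greedyStep {V : Type*} (w : Sym2 V → ℝ≥0) (ε : ℝ≥0)
    (H : SimpleGraph V) (e : Sym2 V) : SimpleGraph V :=
  if (1 + ε) * (w e : ℝ≥0∞) < edgeDist w H e then H ⊔ SimpleGraph.fromEdgeSet {e} else H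

/-- The greedy algorithm: start with `T` and process the edges of the list `l` in order. -/
noncomputable def greedySpanner {V : Type*} (w : Sym2 V → ℝ≥0) (ε : ℝ≥0)
    (T : SimpleGraph V) (l : List (Sym2 V)) : SimpleGraph V :=
  l.foldl (greedyStep w ε) T

/-- `l` enumerates the edges of `G` outside `T` in non-decreasing order of weight. -/
def IsGreedyOrder {V : Type*} (w : Sym2 V → ℝ≥0) (G T : SimpleGraph V)
    (l : List (Sym2 V)) : Prop :=
  l.Nodup ∧ (∀ e, e ∈ l ↔ e ∈ G.edgeSet ∧ e ∉ T.edgeSet) ∧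
    l.Pairwise (fun e f => w e ≤ w f)

/-!
The greedy algorithm produces a spanner for elementary reasons; the point is its weight.

Let `T` be the spanning tree, `d` the distance in `T`, and `H` the output of the greedy algorithm.
Two different edges `xy` and `x'y'` of `H` outside `T` satisfy
`(1 + ε) w(xy) ≤ d(x, x') + d(y, y') + w(x'y')`, whichever was selected first
(`mul_weight_le_detour`). If the edges of `H` outside `T` are visited in any order, adding up these
inequalities for consecutive edges bounds `ε` times their total weight by the length of a tour
through the points `(x, y)` of `T × T`, with distances added in both coordinates, plus `w(T)` for
the last edge (`sum_le_chainCost`). So it suffices to find a tour of length `O(k³) w(T)` in `T × T`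
through all pairs of adjacent vertices of `G`.

Sweeping a caterpillar decomposition along its central path orders the vertices by the time at which
they disappear, with bags of at most `2k + 2` vertices (`HasCaterpillarDecomposition.exists_rank`).
Suppose that for every vertex `v` except the last a vertex `b v` is chosen that lies in the bag of
`v` at the time when `v` disappears, and disappears later. Two tokens on adjacent vertices, where
always the earlier one, `v`, moves to `b v`, share a bag forever, and end on the last vertex. These
moves connect all required points of `T × T`, and going back and forth along them gives a tour of
length at most `4(2k + 2) ∑ d(v, b v)` (`exists_tour_of_adj`).

The choice of `b` with `∑ d(v, b v) = O(k²) w(T)` is the heart of the matter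
(`exists_later_bagmate`). It is done by induction on the bag size, removing the records of a path
from the first to the last vertex, that is, the vertices which disappear later than all vertices
before them on the path: the bag of every other vertex contains a record, so bags get smaller. A
vertex moves within its component of the rest as long as possible, then to a record and along the
path. An edge of the path is used in this way only by components which have a vertex in one
particular bag.
-/

/-! ### Later vertices of the same bag -/

/-- A vertex which is not the largest vertex of its connected component. -/
def HasLater {V : Type*} [LinearOrder V] (T : SimpleGraph V) (v : V) : Prop :=
  ∃ u, T.Reachable v u ∧ v < u

/-- For a linear order on the vertices, thought of as the order in which vertices disappear
when a path decomposition is swept, the bag at the moment `u` disappears: the vertices `v ≥ u`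
that are `u` itself or have a neighbour `z ≤ u`. -/
def frontierAt {V : Type*} [LinearOrder V] (T : SimpleGraph V) (u : V) : Set V :=
  {v | u ≤ v ∧ ∃ z ≤ u, z = v ∨ T.Adj z v}

section Order

variable {V : Type*} [LinearOrder V]

theorem self_mem_frontierAt (T : SimpleGraph V) (u : V) : u ∈ frontierAt T u :=
  ⟨le_rfl, u, le_rfl, Or.inl rfl⟩

theorem frontierAt_mono {T T' : SimpleGraph V} (h : T ≤ T') (u : V) :
    frontierAt T u ⊆ frontierAt T' u := by
  rintro v ⟨huv, z, hz, rfl | hadj⟩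
  · exact ⟨huv, z, hz, Or.inl rfl⟩
  · exact ⟨huv, z, hz, Or.inr (h hadj)⟩

theorem SimpleGraph.Reachable.exists_adj_crossing {T : SimpleGraph V} {x y t : V}
    (h : T.Reachable x y) (hx : x ≤ t) (hy : t < y) :
    ∃ z z', z ≤ t ∧ t < z' ∧ T.Adj z z' ∧ T.Reachable x z' := by
  rw [SimpleGraph.reachable_iff_reflTransGen] at h
  induction h with
  | refl => exact absurd hy (not_lt.mpr hx)
  | @tail b c hab hbc ih =>
    by_cases hb : t < b
    · exact ih hb
    · have hxb : T.Reachable x b := by rwa [SimpleGraph.reachable_iff_reflTransGen]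
      exact ⟨b, c, not_lt.mp hb, hy, hbc, hxb.trans hbc.reachable⟩

/-- Every connected component is traversed by a simple path from its smallest to its largest
vertex, written as a sequence `p 0, …, p N`. -/
theorem exists_path_min_to_max [Finite V] (T : SimpleGraph V) (v : V) :
    ∃ (p : ℕ → V) (N : ℕ), (∀ n ≤ N, T.Reachable v (p n)) ∧ Set.InjOn p (Set.Iic N) ∧
      (∀ n < N, T.Adj (p n) (p (n + 1))) ∧ (∀ x, T.Reachable v x → p 0 ≤ x ∧ x ≤ p N) := by
  have hfin : {x | T.Reachable v x}.Finite := Set.toFinite _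
  have hne : {x | T.Reachable v x}.Nonempty := ⟨v, SimpleGraph.Reachable.refl v⟩
  obtain ⟨a, ha, hamin⟩ := Set.exists_min_image _ id hfin hne
  obtain ⟨b, hb, hbmax⟩ := Set.exists_max_image _ id hfin hne
  have ha' : T.Reachable v a := ha
  have hb' : T.Reachable v b := hb
  obtain ⟨q, hq⟩ := (ha'.symm.trans hb').exists_isPath
  refine ⟨q.getVert, q.length, fun n _ => ?_, hq.getVert_injOn, fun n hn => q.adj_getVert_succ hn,
    fun x hx => ?_⟩
  · exact ha'.trans (q.take n).reachable
  · rw [q.getVert_zero, q.getVert_length]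
    exact ⟨hamin x hx, hbmax x hx⟩

/-- The main combinatorial lemma. Suppose all bags, restricted to a connected component, have at
most `n + 1` vertices. When `v` disappears and is not the last vertex of its component, a token
standing on `v` can be moved to a later vertex `b v` of the current bag, along the edges of a set
`S v`, so that every edge is used for at most `n * (n + 4)` different `v`.

The proof is by induction on `n`. In each component take a path from the first vertex to the last
one; its records (the vertices later than all vertices before them on the path) form a set `F`
which meets the bag of every vertex outside `F`, so these bags shrink when the edges at `F` are removed. A vertex which is last in
its component of the remaining graph walks to `F` within this component, and then along the path up
to a later vertex. -/
theorem exists_later_bagmate [Finite V] (n : ℕ) : ∀ T : SimpleGraph V,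
    (∀ u, {v | v ∈ frontierAt T u ∧ T.Reachable u v}.ncard ≤ n + 1) →
    ∃ (b : V → V) (S : V → Set (Sym2 V)),
      (∀ v, HasLater T v → v < b v ∧ (∃ z ≤ v, T.Adj z (b v)) ∧ S v ⊆ T.edgeSet ∧
        (SimpleGraph.fromEdgeSet (S v)).Reachable v (b v)) ∧
      ∀ f, {v | HasLater T v ∧ f ∈ S v}.ncard ≤ n * (n + 4) := by
  induction n with
  | zero =>
    intro T hT
    have hno : ∀ v, ¬ HasLater T v := by
      rintro v ⟨u, hvu, hlt⟩
      obtain ⟨z, z', hz, hz', hadj, hr⟩ := hvu.exists_adj_crossing le_rfl hlt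
      have h1 := hT v
      rw [zero_add, Set.ncard_le_one (Set.toFinite _)] at h1
      exact hz'.ne (h1 v ⟨self_mem_frontierAt T v, SimpleGraph.Reachable.refl v⟩ z'
        ⟨⟨hz'.le, z, hz, Or.inr hadj⟩, hr⟩)
    refine ⟨id, fun _ => ∅, fun v hv => (hno v hv).elim, fun f => ?_⟩
    simp
  | succ n ih =>
    intro T hT
    have hpath : ∀ c : T.ConnectedComponent, ∃ (p : ℕ → V) (N : ℕ),
        (∀ n ≤ N, T.connectedComponentMk (p n) = c) ∧ Set.InjOn p (Set.Iic N) ∧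
        (∀ n < N, T.Adj (p n) (p (n + 1))) ∧
        (∀ x, T.connectedComponentMk x = c → p 0 ≤ x ∧ x ≤ p N) := by
      intro c
      induction c using SimpleGraph.ConnectedComponent.ind with
      | _ v =>
        obtain ⟨p, N, h1, h2, h3, h4⟩ := exists_path_min_to_max T v
        exact ⟨p, N, fun m hm => SimpleGraph.ConnectedComponent.sound (h1 m hm).symm, h2, h3,
          fun x hx => h4 x (SimpleGraph.ConnectedComponent.exact hx).symm⟩
    choose P M hPc hPinj hPadj hPext using hpath
    let q : V → ℕ → V := fun v => P (T.connectedComponentMk v)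
    let N : V → ℕ := fun v => M (T.connectedComponentMk v)
    have hqeq : ∀ {u v}, T.Reachable u v → q u = q v ∧ N u = N v := by
      intro u v h
      have := SimpleGraph.ConnectedComponent.sound h
      exact ⟨congrArg P this, congrArg M this⟩
    have hqr : ∀ v, ∀ m ≤ N v, T.Reachable v (q v m) := fun v m hm =>
      (SimpleGraph.ConnectedComponent.exact (hPc _ m hm)).symm
    have hqinj : ∀ v, Set.InjOn (q v) (Set.Iic (N v)) := fun v => hPinj _
    have hqadj : ∀ v, ∀ m < N v, T.Adj (q v m) (q v (m + 1)) := fun v => hPadj _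
    have hq0 : ∀ v, q v 0 ≤ v := fun v => (hPext _ v rfl).1
    have hqmax : ∀ v x, T.Reachable v x → x ≤ q v (N v) := fun v x hvx =>
      (hPext _ x (SimpleGraph.ConnectedComponent.sound hvx).symm).2
    have hqN : ∀ v, HasLater T v → v < q v (N v) := by
      rintro v ⟨u, hvu, hlt⟩
      exact hlt.trans_le (hqmax v u hvu)
    clear_value q N
    -- the records along the chosen paths
    let F : Set V := {v | ∃ m ≤ N v, q v m = v ∧ ∀ i < m, q v i < v}
    let T₂ : SimpleGraph V :=
      { Adj := fun x y => T.Adj x y ∧ x ∉ F ∧ y ∉ F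
        symm := ⟨fun x y h => ⟨h.1.symm, h.2.2, h.2.1⟩⟩
        loopless := ⟨fun x h => h.1.ne rfl⟩ }
    have hT₂ : T₂ ≤ T := fun x y h => h.1
    have hiso : ∀ v x, v ∈ F → T₂.Reachable v x → x = v := by
      intro v x hv hx
      rw [SimpleGraph.reachable_iff_reflTransGen] at hx
      induction hx with
      | refl => rfl
      | tail _ h2 ih => exact absurd hv (ih ▸ h2.2.1)
    have hfirst : ∀ v, HasLater T v → ∀ a ≤ N v, ∃ m, a ≤ m ∧ m ≤ N v ∧ v < q v m ∧
        ∀ j, a ≤ j → j < m → q v j ≤ v := by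
      classical
      intro v hv a ha
      have hex : ∃ m, a ≤ m ∧ v < q v m := ⟨N v, ha, hqN v hv⟩
      refine ⟨Nat.find hex, (Nat.find_spec hex).1, Nat.find_min' hex ⟨ha, hqN v hv⟩,
        (Nat.find_spec hex).2, fun j hj hlt => ?_⟩
      have := Nat.find_min hex hlt
      exact not_lt.mp fun h => this ⟨hj, h⟩
    have hrecF : ∀ v m, m ≤ N v → (∀ i < m, q v i < q v m) → q v m ∈ F := by
      intro v m hm hi
      obtain ⟨h1, h2⟩ := hqeq (hqr v m hm)
      exact ⟨m, h2 ▸ hm, by rw [← h1], fun i him => by rw [← h1]; exact hi i him⟩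
    have hmaxF : ∀ v, q v (N v) ∈ F := by
      intro v
      refine hrecF v _ le_rfl fun i hi => lt_of_le_of_ne (hqmax v _ (hqr v i hi.le)) fun h => ?_
      exact hi.ne (hqinj v (Set.mem_Iic.mpr hi.le) (Set.mem_Iic.mpr le_rfl) h)
    have hwidth : ∀ u, {v | v ∈ frontierAt T₂ u ∧ T₂.Reachable u v}.ncard ≤ n + 1 := by
      intro u
      by_cases hu : u ∈ F
      · refine le_trans ?_ (Nat.le_add_left 1 n)
        rw [Set.ncard_le_one (Set.toFinite _)]
        rintro x ⟨-, hx⟩ y ⟨-, hy⟩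
        rw [hiso u x hu hx, hiso u y hu hy]
      · have hlater : HasLater T u := by
          refine ⟨q u (N u), hqr u _ le_rfl, lt_of_le_of_ne (hqmax u u (.refl u)) fun h => hu ?_⟩
          have := hmaxF u
          rwa [← h] at this
        obtain ⟨m, -, hmN, hum, hbefore⟩ := hfirst u hlater 0 (Nat.zero_le _)
        have hm0 : 0 < m := by
          rcases Nat.eq_zero_or_pos m with rfl | h
          · exact absurd hum (not_lt.mpr (hq0 u))
          · exact h
        have hmF : q u m ∈ F :=
          hrecF u m hmN fun i hi => (hbefore i (Nat.zero_le _) hi).trans_lt hum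
        have hmem : q u m ∈ {v | v ∈ frontierAt T u ∧ T.Reachable u v} := by
          refine ⟨⟨hum.le, q u (m - 1), hbefore _ (Nat.zero_le _) (by omega), Or.inr ?_⟩,
            hqr u m hmN⟩
          have := hqadj u (m - 1) (by omega)
          rwa [Nat.sub_add_cancel hm0] at this
        have hssub : {v | v ∈ frontierAt T₂ u ∧ T₂.Reachable u v} ⊂
            {v | v ∈ frontierAt T u ∧ T.Reachable u v} := by
          refine ⟨fun v hv => ⟨frontierAt_mono hT₂ u hv.1, hv.2.mono hT₂⟩, fun hsub => ?_⟩
          have h1 := hiso _ u hmF (hsub hmem).2.symm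
          exact hum.ne h1
        have := Set.ncard_lt_ncard hssub (Set.toFinite _)
        have := hT u
        omega
    obtain ⟨b₂, S₂, hb₂, hS₂⟩ := ih T₂ hwidth
    -- every vertex reaches `F` by at most one edge leaving its component of `T₂`
    have hreach : ∀ v, ∃ c f, T₂.Reachable v c ∧ f ∈ F ∧ (c = f ∨ T.Adj c f) := by
      have key : ∀ x y, T.Walk x y → y ∈ F →
          ∃ c f, T₂.Reachable x c ∧ f ∈ F ∧ (c = f ∨ T.Adj c f) := by
        intro x y p
        induction p with
        | nil => exact fun hy => ⟨_, _, .refl _, hy, Or.inl rfl⟩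
        | @cons x x' y h p ihp =>
          intro hy
          by_cases hx : x ∈ F
          · exact ⟨x, x, .refl _, hx, Or.inl rfl⟩
          by_cases hx' : x' ∈ F
          · exact ⟨x, x', .refl _, hx', Or.inr h⟩
          obtain ⟨c, f, h1, h2, h3⟩ := ihp hy
          have hadj : T₂.Adj x x' := ⟨h, hx, hx'⟩
          exact ⟨c, f, hadj.reachable.trans h1, h2, h3⟩
      intro v
      obtain ⟨p⟩ := hqr v _ le_rfl
      exact key v _ p (hmaxF v)
    have hexit : ∀ v, ∃ c a m, HasLater T v → T₂.Reachable v c ∧ (c = q v a ∨ T.Adj c (q v a)) ∧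
        a ≤ m ∧ m ≤ N v ∧ v < q v m ∧ (∀ j < m, a ≤ j → q v j ≤ v) ∧
        (∀ i < a, q v i < q v a) := by
      intro v
      by_cases hv : HasLater T v
      · obtain ⟨c, f, h1, ⟨a, haN, haf, hrec⟩, h3⟩ := hreach v
        have hvf : T.Reachable v f := by
          rcases h3 with rfl | h3
          · exact h1.mono hT₂
          · exact (h1.mono hT₂).trans h3.reachable
        obtain ⟨e1, e2⟩ := hqeq hvf
        rw [← e1] at haf hrec
        rw [← e2] at haN
        obtain ⟨m, hm1, hm2, hm3, hm4⟩ := hfirst v hv a haN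
        refine ⟨c, a, m, fun _ => ⟨h1, by rwa [haf], hm1, hm2, hm3, fun j hj ha => hm4 j ha hj, ?_⟩⟩
        rwa [haf]
      · exact ⟨v, 0, 0, fun h => (hv h).elim⟩
    choose c a m hexit using hexit
    classical
    -- the moves inside and out of the component of `v` in `T₂`, and then along the path
    let touch : V → Set (Sym2 V) := fun v => {e | e ∈ T.edgeSet ∧ ∃ x ∈ e, T₂.Reachable v x}
    let climb : V → Set (Sym2 V) := fun v =>
      {e | ∃ j, a v ≤ j ∧ j < m v ∧ e = s(q v j, q v (j + 1))}
    refine ⟨fun v => if HasLater T₂ v then b₂ v else q v (m v),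
      fun v => if HasLater T₂ v then S₂ v else touch v ∪ climb v, fun v hv => ?_, fun f => ?_⟩
    · by_cases hv2 : HasLater T₂ v
      · simp only [hv2, if_true]
        obtain ⟨h1, ⟨z, hz, hadj⟩, h3, h4⟩ := hb₂ v hv2
        exact ⟨h1, ⟨z, hz, hT₂ hadj⟩, h3.trans (SimpleGraph.edgeSet_mono hT₂), h4⟩
      · simp only [hv2, if_false]
        obtain ⟨hc, hca, ham, hmN, hvm, hle, -⟩ := hexit v hv
        refine ⟨hvm, ?_, ?_, ?_⟩
        · rcases ham.eq_or_lt with h | h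
          · rw [← h] at hvm ⊢
            have hcv : c v ≤ v := not_lt.mp fun hlt => hv2 ⟨_, hc, hlt⟩
            rcases hca with hca | hca
            · exact absurd hvm (not_lt.mpr (hca ▸ hcv))
            · exact ⟨c v, hcv, hca⟩
          · refine ⟨q v (m v - 1), hle _ (by omega) (by omega), ?_⟩
            have := hqadj v (m v - 1) (by omega)
            rwa [Nat.sub_add_cancel (by omega)] at this
        · rintro e (he | ⟨j, -, hj, rfl⟩)
          · exact he.1
          · exact hqadj v j (by omega)
        · have h1 : ∀ x, T₂.Reachable v x →
              (SimpleGraph.fromEdgeSet (touch v ∪ climb v)).Reachable v x := by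
            intro x hx
            rw [SimpleGraph.reachable_iff_reflTransGen] at hx
            induction hx with
            | refl => exact .refl _
            | @tail x y hvx hxy ihx =>
              rw [← SimpleGraph.reachable_iff_reflTransGen] at hvx
              refine ihx.trans (SimpleGraph.Adj.reachable ?_)
              rw [SimpleGraph.fromEdgeSet_adj]
              exact ⟨Or.inl ⟨hT₂ hxy, x, Sym2.mem_mk_left _ _, hvx⟩, hxy.ne⟩
          have h2 : (SimpleGraph.fromEdgeSet (touch v ∪ climb v)).Reachable v (q v (a v)) := by
            rcases hca with hca | hca
            · rw [← hca]; exact h1 _ hc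
            · refine (h1 _ hc).trans (SimpleGraph.Adj.reachable ?_)
              rw [SimpleGraph.fromEdgeSet_adj]
              exact ⟨Or.inl ⟨hca, _, Sym2.mem_mk_left _ _, hc⟩, hca.ne⟩
          have h3 : ∀ j, a v ≤ j → j ≤ m v →
              (SimpleGraph.fromEdgeSet (touch v ∪ climb v)).Reachable v (q v j) := by
            intro j hj
            induction j, hj using Nat.le_induction with
            | base => exact fun _ => h2
            | succ j hj ihj =>
              intro hjm
              refine (ihj (by omega)).trans (SimpleGraph.Adj.reachable ?_)
              rw [SimpleGraph.fromEdgeSet_adj]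
              exact ⟨Or.inr ⟨j, hj, by omega, rfl⟩, (hqadj v j (by omega)).ne⟩
          exact h3 _ ham le_rfl
    · -- distinct vertices that are last in their components of `T₂` have distinct components
      have huniq : ∀ v v' x, ¬ HasLater T₂ v → ¬ HasLater T₂ v' → T₂.Reachable v x →
          T₂.Reachable v' x → v = v' := by
        intro v v' x hv hv' h h'
        refine le_antisymm ?_ ?_
        · exact not_lt.mp fun hlt => hv' ⟨v, h'.trans h.symm, hlt⟩
        · exact not_lt.mp fun hlt => hv ⟨v', h.trans h'.symm, hlt⟩
      let A₁ : Set V := {v | HasLater T₂ v ∧ f ∈ S₂ v}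
      let A₂ : Set V := {v | ¬ HasLater T₂ v ∧ ∃ x ∈ f, T₂.Reachable v x}
      let A₃ : Set V := {v | HasLater T v ∧ ¬ HasLater T₂ v ∧ f ∈ climb v}
      have hsub : {v | HasLater T v ∧
          f ∈ (if HasLater T₂ v then S₂ v else touch v ∪ climb v)} ⊆ A₁ ∪ (A₂ ∪ A₃) := by
        rintro v ⟨hv, hf⟩
        by_cases hv2 : HasLater T₂ v
        · rw [if_pos hv2] at hf
          exact Or.inl ⟨hv2, hf⟩
        · rw [if_neg hv2] at hf
          rcases hf with hf | hf
          · exact Or.inr (Or.inl ⟨hv2, hf.2⟩)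
          · exact Or.inr (Or.inr ⟨hv, hv2, hf⟩)
      have hA₁ : A₁.ncard ≤ n * (n + 4) := hS₂ f
      have hA₂ : A₂.ncard ≤ 2 := by
        have hone : ∀ z, {v | ¬ HasLater T₂ v ∧ T₂.Reachable v z}.ncard ≤ 1 := by
          intro z
          rw [Set.ncard_le_one (Set.toFinite _)]
          rintro v ⟨hv, hvz⟩ v' ⟨hv', hvz'⟩
          exact huniq v v' z hv hv' hvz hvz'
        obtain ⟨x, y, hxy⟩ : ∃ x y, f = s(x, y) := ⟨_, _, (Quot.out_eq f).symm⟩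
        have hsub₂ : A₂ ⊆ {v | ¬ HasLater T₂ v ∧ T₂.Reachable v x} ∪
            {v | ¬ HasLater T₂ v ∧ T₂.Reachable v y} := by
          rintro v ⟨hv, z, hz, hvz⟩
          rw [hxy] at hz
          rcases Sym2.mem_iff.mp hz with rfl | rfl
          · exact Or.inl ⟨hv, hvz⟩
          · exact Or.inr ⟨hv, hvz⟩
        have h1 := Set.ncard_le_ncard hsub₂ (Set.toFinite _)
        have h2 := Set.ncard_union_le {v | ¬ HasLater T₂ v ∧ T₂.Reachable v x}
            {v | ¬ HasLater T₂ v ∧ T₂.Reachable v y}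
        have := hone x
        have := hone y
        omega
      have hA₃ : A₃.ncard ≤ n + 2 := by
        rcases A₃.eq_empty_or_nonempty with h0 | ⟨v₀, hv₀, -, j₀, hj₀a, hj₀m, hf₀⟩
        · rw [h0]; simp
        · obtain ⟨-, -, -, hm₀, -, -, -⟩ := hexit v₀ hv₀
          -- the latest vertex on the part of the path before `f`
          obtain ⟨i₀, hi₀, hi₀max⟩ := Finset.exists_max_image (Finset.range (j₀ + 1)) (q v₀)
            ⟨0, by simp⟩
          have hi₀' : i₀ ≤ j₀ := by simpa [Nat.lt_succ_iff] using hi₀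
          set τ := q v₀ i₀ with hτ
          -- each component climbing over `f` contains a vertex of the bag of `τ`
          have hmap : ∀ v ∈ A₃, ∃ x, T₂.Reachable v x ∧ x ∈ frontierAt T τ ∧ T.Reachable τ x := by
            rintro v ⟨hv, hv2, j, hja, hjm, hf⟩
            obtain ⟨hc, hca, ham, hmN, hvm, hle, hrec⟩ := hexit v hv
            have hvv : T.Reachable v₀ v := by
              have h1 : q v₀ j₀ ∈ f := by rw [hf₀]; exact Sym2.mem_mk_left _ _
              rw [hf] at h1
              have h2 := hqr v₀ j₀ (by omega)
              rcases Sym2.mem_iff.mp h1 with h | h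
              · rw [h] at h2; exact h2.trans (hqr v j (by omega)).symm
              · rw [h] at h2; exact h2.trans (hqr v (j + 1) (by omega)).symm
            obtain ⟨e1, e2⟩ := hqeq hvv
            have hjj : j = j₀ := by
              rw [hf₀, ← e1] at hf
              rw [← e2] at hmN
              have hinj := hqinj v₀
              rcases Sym2.eq_iff.mp hf with ⟨h, -⟩ | ⟨h, h'⟩
              · exact (hinj (Set.mem_Iic.mpr (by omega)) (Set.mem_Iic.mpr (by omega)) h).symm
              · have := hinj (Set.mem_Iic.mpr (by omega)) (Set.mem_Iic.mpr (by omega)) h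
                have := hinj (Set.mem_Iic.mpr (by omega)) (Set.mem_Iic.mpr (by omega)) h'
                omega
            subst hjj
            have hτr : T.Reachable τ v := (hqr v₀ i₀ (by omega)).symm.trans hvv
            have hτv : τ ≤ v := by
              rw [hτ, e1]
              rcases le_or_gt (a v) i₀ with h | h
              · exact hle _ (by omega) h
              · exact (hrec _ h).le.trans (hle _ (by omega) le_rfl)
            have haτ : q v (a v) ≤ τ := by
              rw [← e1]
              exact hi₀max _ (by simp; omega)
            rcases hτv.eq_or_lt with h | hlt
            · exact ⟨τ, h ▸ .refl _, self_mem_frontierAt T τ, .refl _⟩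
            · by_cases hcτ : τ < c v
              · refine ⟨c v, hc, ⟨hcτ.le, q v (a v), haτ, Or.inr ?_⟩, hτr.trans (hc.mono hT₂)⟩
                rcases hca with hca | hca
                · exact absurd hcτ (not_lt.mpr (hca ▸ haτ))
                · exact hca.symm
              · obtain ⟨z, z', hz, hz', hadj, hr⟩ :=
                  hc.symm.exists_adj_crossing (not_lt.mp hcτ) hlt
                have hvz := hc.trans hr
                exact ⟨z', hvz, ⟨hz'.le, z, hz, Or.inr (hT₂ hadj)⟩, hτr.trans (hvz.mono hT₂)⟩
          choose! g hg using hmap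
          refine (Set.ncard_le_ncard_of_injOn g (fun v hv => (hg v hv).2) ?_ (Set.toFinite _)).trans
            (hT τ)
          intro v hv v' hv' hgg
          exact huniq v v' (g v) hv.2.1 hv'.2.1 (hg v hv).1 (hgg ▸ (hg v' hv').1)
      have h1 := Set.ncard_le_ncard hsub (Set.toFinite _)
      have h2 := Set.ncard_union_le A₁ (A₂ ∪ A₃)
      have h3 := Set.ncard_union_le A₂ A₃
      refine h1.trans (h2.trans ?_)
      nlinarith

end Order

/-! ### Tours -/

/-- The length of a sequence of points, with respect to a distance function `D`. -/
noncomputable def chainCost {α : Type*} (D : α → α → ℝ≥0∞) : List α → ℝ≥0∞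
  | [] => 0
  | [_] => 0
  | a :: b :: l => D a b + chainCost D (b :: l)

section ChainCost

variable {α : Type*} {D : α → α → ℝ≥0∞}

theorem chainCost_cons_le_of_sublist (htri : ∀ a b c, D a c ≤ D a b + D b c) {l' l : List α}
    (h : l'.Sublist l) : ∀ a, chainCost D (a :: l') ≤ chainCost D (a :: l) := by
  induction h with
  | slnil => exact fun a => le_rfl
  | @cons l' l b h ih =>
    intro a
    refine (ih a).trans ?_
    cases l with
    | nil => simp [chainCost]
    | cons c t =>
      simp only [chainCost, ← add_assoc]
      gcongr
      exact htri a b c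
  | @cons_cons l' l b h ih =>
    intro a
    simp only [chainCost]
    gcongr
    exact ih b

theorem chainCost_le_of_sublist (htri : ∀ a b c, D a c ≤ D a b + D b c) {l' l : List α}
    (h : l'.Sublist l) : chainCost D l' ≤ chainCost D l := by
  induction h with
  | slnil => exact le_rfl
  | @cons l' l b h ih =>
    refine ih.trans ?_
    cases l with
    | nil => simp [chainCost]
    | cons c t => simp [chainCost]
  | @cons_cons l' l b h ih => exact chainCost_cons_le_of_sublist htri h b

theorem chainCost_detour (l₁ l₂ : List α) (x y : α) :
    chainCost D (l₁ ++ x :: y :: x :: l₂) = chainCost D (l₁ ++ x :: l₂) + (D x y + D y x) := by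
  induction l₁ with
  | nil => simp only [List.nil_append, chainCost]; ring
  | cons a t ih =>
    cases t with
    | nil => simp only [List.cons_append, List.nil_append, chainCost] at ih ⊢; ring
    | cons b t =>
      simp only [List.cons_append, chainCost] at ih ⊢
      rw [ih]; ring

/-- A tour can be extended so that it becomes closed under finitely many undirected jumps
`f i — g i`, every jump being made at most once in each direction. -/
theorem exists_closed_tour {ι : Type*} (f g : ι → α) (Z : Finset ι) : ∀ L : List α,
    ∃ L' : List α, L ⊆ L' ∧ (∀ i ∈ Z, f i ∈ L' ↔ g i ∈ L') ∧
      chainCost D L' ≤ chainCost D L + ∑ i ∈ Z, (D (f i) (g i) + D (g i) (f i)) := by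
  classical
  induction Z using Finset.strongInduction with
  | H Z ih =>
    have step : ∀ (L : List α) (i : ι) (x y : α), i ∈ Z → x ∈ L →
        (x = f i ∧ y = g i ∨ x = g i ∧ y = f i) →
        ∃ L' : List α, L ⊆ L' ∧ (∀ i ∈ Z, f i ∈ L' ↔ g i ∈ L') ∧
          chainCost D L' ≤ chainCost D L + ∑ i ∈ Z, (D (f i) (g i) + D (g i) (f i)) := by
      intro L i x y hi hx hxy
      obtain ⟨l₁, l₂, rfl⟩ := List.append_of_mem hx
      obtain ⟨L', h1, h2, h3⟩ :=
        ih (Z.erase i) (Finset.erase_ssubset hi) (l₁ ++ x :: y :: x :: l₂)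
      have hxL : x ∈ L' := h1 (by simp)
      have hyL : y ∈ L' := h1 (by simp)
      refine ⟨L', fun z hz => h1 ?_, fun j hj => ?_, h3.trans ?_⟩
      · simp only [List.mem_append, List.mem_cons] at hz ⊢
        tauto
      · by_cases hji : j = i
        · subst hji
          rcases hxy with ⟨rfl, rfl⟩ | ⟨rfl, rfl⟩ <;> simp [hxL, hyL]
        · exact h2 j (Finset.mem_erase.mpr ⟨hji, hj⟩)
      · rw [chainCost_detour, ← Finset.add_sum_erase Z _ hi, add_assoc]
        rcases hxy with ⟨rfl, rfl⟩ | ⟨rfl, rfl⟩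
        · exact le_rfl
        · rw [add_comm (D (g i) (f i))]
    intro L
    by_cases hcl : ∀ i ∈ Z, f i ∈ L ↔ g i ∈ L
    · exact ⟨L, List.Subset.refl L, hcl, le_self_add⟩
    · push Not at hcl
      obtain ⟨i, hi, hfg⟩ := hcl
      rcases hfg with ⟨h, -⟩ | ⟨-, h⟩
      · exact step L i _ _ hi h (Or.inl ⟨rfl, rfl⟩)
      · exact step L i _ _ hi h (Or.inr ⟨rfl, rfl⟩)

/-- If each point of a list of length `chainCost D L` can be compared with the following ones by
`c * W x ≤ D x y + W y`, and with an absolute bound `M`, then the inequalities telescope. -/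
theorem sum_le_chainCost {W : α → ℝ≥0∞} {c M : ℝ≥0∞} : ∀ L : List α,
    L.Pairwise (fun x y => c * W x ≤ D x y + W y) → (∀ x ∈ L, c * W x ≤ M) →
    c * (L.map W).sum ≤ (L.tail.map W).sum + chainCost D L + M
  | [], _, _ => by simp
  | [x], _, hM => by simpa [chainCost] using hM x
  | x :: y :: l, hp, hM => by
    have ih := sum_le_chainCost (y :: l) hp.tail fun z hz => hM z (List.mem_cons_of_mem _ hz)
    have hxy := (List.pairwise_cons.mp hp).1 y (by simp)
    rw [List.map_cons, List.sum_cons, mul_add]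
    refine (add_le_add hxy ih).trans (le_of_eq ?_)
    simp only [List.tail_cons, List.map_cons, List.sum_cons, chainCost]
    ring

end ChainCost

open Classical in
/-- Two tokens on adjacent vertices of `G`, where always the token on the earlier vertex `v` moves
to `b v`, stay in a common bag and meet in the last vertex. Hence a tour of `V × V` closed under
these moves visits all edges of `G`, and each `v` accounts for at most `2 * K` moves. -/
theorem exists_tour_of_adj {V : Type*} [Fintype V] [Nonempty V] [LinearOrder V]
    (G : SimpleGraph V) (K : ℕ) (hK : ∀ u, (frontierAt G u).ncard ≤ K) (b : V → V)
    (hb : ∀ v, ¬ IsMax v → v < b v ∧ ∃ z ≤ v, G.Adj z (b v)) (d : V → V → ℝ≥0∞)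
    (hself : ∀ x, d x x = 0) (hcomm : ∀ x y, d x y = d y x) (M : ℝ≥0∞)
    (hM : ∑ v with ¬ IsMax v, d v (b v) ≤ M) :
    ∃ L : List (V × V), (∀ x y, G.Adj x y → (x, y) ∈ L) ∧
      chainCost (fun p q => d p.1 q.1 + d p.2 q.2) L ≤ 4 * K * M := by
  obtain ⟨ρ, -, hρ⟩ := Finset.exists_max_image (Finset.univ : Finset V) id Finset.univ_nonempty
  have hρ' : ∀ x, x ≤ ρ := fun x => hρ x (Finset.mem_univ x)
  let Z₀ : Finset (Σ _ : V, V) :=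
    (Finset.univ.filter fun v : V => ¬ IsMax v).sigma fun v => (frontierAt G v).toFinset
  let f : (Σ _ : V, V) ⊕ (Σ _ : V, V) → V × V := Sum.elim (fun i => (i.1, i.2)) fun i => (i.2, i.1)
  let g : (Σ _ : V, V) ⊕ (Σ _ : V, V) → V × V :=
    Sum.elim (fun i => (b i.1, i.2)) fun i => (i.2, b i.1)
  obtain ⟨L, hL, hcl, hcost⟩ := exists_closed_tour
    (D := fun p q : V × V => d p.1 q.1 + d p.2 q.2) f g (Z₀.disjSum Z₀) [(ρ, ρ)]
  refine ⟨L, ?_, hcost.trans ?_⟩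
  · have hZ : ∀ v y, ¬ IsMax v → y ∈ frontierAt G v →
        ((v, y) ∈ L ↔ (b v, y) ∈ L) ∧ ((y, v) ∈ L ↔ (y, b v) ∈ L) := by
      intro v y hv hy
      have h0 : (⟨v, y⟩ : Σ _ : V, V) ∈ Z₀ := by
        simp only [Z₀, Finset.mem_sigma, Finset.mem_filter, Finset.mem_univ, true_and,
          Set.mem_toFinset]
        exact ⟨hv, hy⟩
      exact ⟨hcl (Sum.inl ⟨v, y⟩) (Finset.inl_mem_disjSum.mpr h0),
        hcl (Sum.inr ⟨v, y⟩) (Finset.inr_mem_disjSum.mpr h0)⟩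
    have key : ∀ (k : ℕ) (x y : V), (Set.Ioi x).ncard + (Set.Ioi y).ncard ≤ k →
        y ∈ frontierAt G x → (x, y) ∈ L ∧ (y, x) ∈ L := by
      intro k
      induction k with
      | zero =>
        intro x y hk _
        have hcard : ∀ z : V, (Set.Ioi z).ncard ≤ 0 → z = ρ := by
          intro z hz
          refine le_antisymm (hρ' z) (not_lt.mp fun hlt => ?_)
          have : ρ ∈ Set.Ioi z := hlt
          rw [(Set.ncard_eq_zero (Set.toFinite _)).mp (Nat.le_zero.mp hz)] at this
          exact this
        rw [hcard x (by omega), hcard y (by omega)]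
        exact ⟨hL (by simp), hL (by simp)⟩
      | succ k ih =>
        intro x y hk hy
        by_cases hx : IsMax x
        · have hxρ : x = ρ := le_antisymm (hρ' x) (hx (hρ' x))
          have hyρ : y = ρ := le_antisymm (hρ' y) (hxρ ▸ hy.1)
          rw [hxρ, hyρ]
          exact ⟨hL (by simp), hL (by simp)⟩
        · obtain ⟨hlt, z, hz, hadj⟩ := hb x hx
          have hcard : (Set.Ioi (b x)).ncard < (Set.Ioi x).ncard := by
            refine Set.ncard_lt_ncard ⟨Set.Ioi_subset_Ioi hlt.le, fun h => ?_⟩ (Set.toFinite _)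
            exact lt_irrefl (b x) (h hlt)
          rw [(hZ x y hx hy).1, (hZ x y hx hy).2]
          rcases le_total (b x) y with h | h
          · obtain ⟨z', hz', h'⟩ := hy.2
            refine ih (b x) y (by omega) ⟨h, ?_⟩
            rcases h' with rfl | h'
            · exact ⟨z', hz'.trans hlt.le, Or.inl rfl⟩
            · exact ⟨z', hz'.trans hlt.le, Or.inr h'⟩
          · exact (ih y (b x) (by omega) ⟨h, z, hz.trans hy.1, Or.inr hadj⟩).symm
    intro x y hxy
    rcases le_total x y with h | h
    · exact (key _ x y le_rfl ⟨h, x, le_rfl, Or.inr hxy⟩).1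
    · exact (key _ y x le_rfl ⟨h, y, le_rfl, Or.inr hxy.symm⟩).2
  · have hsum : ∑ i ∈ Z₀, (d i.1 (b i.1) + d i.1 (b i.1)) ≤ 2 * K * M := by
      rw [Finset.sum_sigma]
      calc _ = ∑ v with ¬ IsMax v, ((frontierAt G v).ncard : ℝ≥0∞) * (2 * d v (b v)) := by
            refine Finset.sum_congr rfl fun v _ => ?_
            dsimp only
            rw [Finset.sum_const, nsmul_eq_mul, Set.ncard_eq_toFinset_card', two_mul]
        _ ≤ ∑ v with ¬ IsMax v, (K : ℝ≥0∞) * (2 * d v (b v)) := by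
            gcongr with v
            exact hK v
        _ = 2 * K * ∑ v with ¬ IsMax v, d v (b v) := by
            rw [Finset.mul_sum]
            exact Finset.sum_congr rfl fun v _ => by ring
        _ ≤ _ := mul_le_mul_right hM _
    rw [Finset.sum_disjSum]
    simp only [f, g, Sum.elim_inl, Sum.elim_inr, chainCost, hself, add_zero, zero_add]
    have hsymm : ∀ v, d (b v) v = d v (b v) := fun v => hcomm _ _
    simp only [hsymm]
    refine (add_le_add hsum hsum).trans (le_of_eq (by ring))

/-! ### Weighted distances and the greedy algorithm -/

section WeightedDist

variable {V : Type*} (w : Sym2 V → ℝ≥0)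

theorem weightedDist_self (G : SimpleGraph V) (x : V) : weightedDist w G x x = 0 :=
  le_antisymm ((iInf_le _ SimpleGraph.Walk.nil).trans (by simp [walkWeight])) zero_le

theorem weightedDist_triangle (G : SimpleGraph V) (x y z : V) :
    weightedDist w G x z ≤ weightedDist w G x y + weightedDist w G y z := by
  unfold weightedDist
  rw [ENNReal.iInf_add]
  refine le_iInf fun p => ?_
  rw [ENNReal.add_iInf]
  refine le_iInf fun q => (iInf_le _ (p.append q)).trans (le_of_eq ?_)
  simp [walkWeight]

theorem weightedDist_le_of_adj {G : SimpleGraph V} {x y : V} (h : G.Adj x y) :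
    weightedDist w G x y ≤ w s(x, y) :=
  (iInf_le _ h.toWalk).trans (by simp [walkWeight])

theorem weightedDist_anti {G H : SimpleGraph V} (h : G ≤ H) (x y : V) :
    weightedDist w H x y ≤ weightedDist w G x y :=
  le_iInf fun p => (iInf_le _ (p.mapLe h)).trans (le_of_eq (by simp [walkWeight]))

theorem weightedDist_le_sum {T : SimpleGraph V} {S : Set (Sym2 V)}
    (hS : S ⊆ T.edgeSet) (F : Finset (Sym2 V)) (hF : S ⊆ F) {x y : V}
    (h : (SimpleGraph.fromEdgeSet S).Reachable x y) :
    weightedDist w T x y ≤ ∑ e ∈ F, (w e : ℝ≥0∞) := by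
  classical
  obtain ⟨p, hp⟩ := h.exists_isPath
  have hle : SimpleGraph.fromEdgeSet S ≤ T := by
    intro a b hab
    exact hS ((SimpleGraph.fromEdgeSet_adj S).mp hab).1
  refine (weightedDist_anti w hle x y).trans ((iInf_le _ p).trans ?_)
  rw [walkWeight, ← List.sum_toFinset _ hp.isTrail.edges_nodup, ENNReal.ofNNReal_finsetSum]
  refine Finset.sum_le_sum_of_subset fun e he => ?_
  have := p.edges_subset_edgeSet (List.mem_toFinset.mp he)
  rw [SimpleGraph.edgeSet_fromEdgeSet] at this
  exact hF this.1

/-- It suffices to check the stretch of a subgraph on the edges. -/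
theorem isSpanner_of_adj {G H : SimpleGraph V} {ε : ℝ≥0} (hHG : H ≤ G)
    (h : ∀ x y, G.Adj x y → weightedDist w H x y ≤ (1 + ε) * w s(x, y)) :
    IsSpanner w ε G H := by
  refine ⟨hHG, fun x y => ?_⟩
  have key : ∀ (x y : V) (p : G.Walk x y), weightedDist w H x y ≤ (1 + ε) * walkWeight w p := by
    intro x y p
    induction p with
    | nil => rw [weightedDist_self]; exact zero_le
    | @cons x z y hxz p ih =>
      refine (weightedDist_triangle w H x z y).trans ((add_le_add (h x z hxz) ih).trans ?_)
      simp [walkWeight, mul_add]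
  unfold weightedDist
  rw [ENNReal.mul_iInf_of_ne (by simp) (by simp)]
  exact le_iInf fun p => key x y p

end WeightedDist

section Greedy

variable {V : Type*} {w : Sym2 V → ℝ≥0} {ε : ℝ≥0}

theorem le_greedyStep (H : SimpleGraph V) (e : Sym2 V) : H ≤ greedyStep w ε H e := by
  unfold greedyStep
  split_ifs
  · exact le_sup_left
  · exact le_rfl

theorem greedySpanner_append (T : SimpleGraph V) (l : List (Sym2 V)) (e : Sym2 V) :
    greedySpanner w ε T (l ++ [e]) = greedyStep w ε (greedySpanner w ε T l) e := by
  simp [greedySpanner]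

theorem mem_edgeSet_greedyStep {H : SimpleGraph V} {e f : Sym2 V}
    (hf : f ∈ (greedyStep w ε H e).edgeSet) :
    f ∈ H.edgeSet ∨ f = e ∧ (1 + ε) * (w e : ℝ≥0∞) < edgeDist w H e := by
  unfold greedyStep at hf
  split_ifs at hf with h
  · rw [SimpleGraph.edgeSet_sup, SimpleGraph.edgeSet_fromEdgeSet] at hf
    rcases hf with hf | hf
    · exact Or.inl hf
    · exact Or.inr ⟨hf.1, h⟩
  · exact Or.inl hf

theorem le_greedySpanner (T : SimpleGraph V) (l : List (Sym2 V)) : T ≤ greedySpanner w ε T l := by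
  induction l using List.reverseRecOn with
  | nil => exact le_rfl
  | append_singleton l e ih =>
    rw [greedySpanner_append]
    exact ih.trans (le_greedyStep _ _)

theorem mem_edgeSet_greedySpanner {T : SimpleGraph V} {l : List (Sym2 V)} {f : Sym2 V}
    (hf : f ∈ (greedySpanner w ε T l).edgeSet) : f ∈ T.edgeSet ∨ f ∈ l := by
  induction l using List.reverseRecOn with
  | nil => exact Or.inl hf
  | append_singleton l e ih =>
    rw [greedySpanner_append] at hf
    rcases mem_edgeSet_greedyStep hf with h | ⟨rfl, -⟩
    · rcases ih h with h | h
      · exact Or.inl h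
      · exact Or.inr (by simp [h])
    · exact Or.inr (by simp)

theorem weightedDist_greedySpanner_le {T : SimpleGraph V} {l : List (Sym2 V)} {x y : V}
    (hxy : x ≠ y) (hl : s(x, y) ∈ l) :
    weightedDist w (greedySpanner w ε T l) x y ≤ (1 + ε) * w s(x, y) := by
  induction l using List.reverseRecOn with
  | nil => simp at hl
  | append_singleton l e ih =>
    rw [greedySpanner_append]
    by_cases h : s(x, y) ∈ l
    · exact (weightedDist_anti w (le_greedyStep _ _) x y).trans (ih h)
    · have he : s(x, y) = e := by simpa [h] using hl
      subst he
      unfold greedyStep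
      split_ifs with hlt
      · refine (weightedDist_le_of_adj w (Or.inr ?_)).trans (le_mul_of_one_le_left' le_self_add)
        rw [SimpleGraph.fromEdgeSet_adj]
        exact ⟨rfl, hxy⟩
      · exact not_lt.mp hlt

theorem mul_weight_le_weightedDist_of_mem_greedySpanner {T : SimpleGraph V} {l : List (Sym2 V)}
    {x y : V} (h : s(x, y) ∈ (greedySpanner w ε T l).edgeSet) (hT : s(x, y) ∉ T.edgeSet) :
    (1 + ε) * (w s(x, y) : ℝ≥0∞) ≤ weightedDist w T x y := by
  induction l using List.reverseRecOn with
  | nil => exact absurd h hT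
  | append_singleton l e ih =>
    rw [greedySpanner_append] at h
    rcases mem_edgeSet_greedyStep h with h | ⟨rfl, h⟩
    · exact ih h
    · exact h.le.trans (weightedDist_anti w (le_greedySpanner T l) x y)

/-- Any two edges selected by the greedy algorithm satisfy the detour inequality, whichever of them
was selected first: if the lighter edge `a` precedes the heavier edge `c`, the inequality
`(1 + ε) * w c ≤ A + w a` obtained when `c` was selected implies `(1 + ε) * w a ≤ A + w c`. -/
theorem mul_weight_le_detour {T : SimpleGraph V} {l : List (Sym2 V)}
    (hl : l.Pairwise fun e f => w e ≤ w f) {x y x' y' : V}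
    (h : s(x, y) ∈ (greedySpanner w ε T l).edgeSet) (hT : s(x, y) ∉ T.edgeSet)
    (h' : s(x', y') ∈ (greedySpanner w ε T l).edgeSet)
    (hne : s(x, y) ≠ s(x', y')) :
    (1 + ε) * (w s(x, y) : ℝ≥0∞) ≤
      weightedDist w T x x' + weightedDist w T y y' + w s(x', y') := by
  have direct : ∀ (l : List (Sym2 V)) (x y x' y' : V),
      (1 + ε) * (w s(x, y) : ℝ≥0∞) < edgeDist w (greedySpanner w ε T l) s(x, y) →
      s(x', y') ∈ (greedySpanner w ε T l).edgeSet →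
      (1 + ε) * (w s(x, y) : ℝ≥0∞) ≤
        weightedDist w T x x' + weightedDist w T y y' + w s(x', y') := by
    intro l x y x' y' hlt h'
    have hle := le_greedySpanner (w := w) (ε := ε) T l
    set H := greedySpanner w ε T l
    calc (1 + ε) * (w s(x, y) : ℝ≥0∞) ≤ weightedDist w H x y := hlt.le
      _ ≤ weightedDist w H x x' + (weightedDist w H x' y' + weightedDist w H y' y) :=
        (weightedDist_triangle w H x x' y).trans
          (by gcongr; exact weightedDist_triangle w H x' y' y)
      _ ≤ weightedDist w T x x' + (w s(x', y') + weightedDist w T y' y) := by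
        gcongr
        · exact weightedDist_anti w hle _ _
        · exact weightedDist_le_of_adj w h'
        · exact weightedDist_anti w hle _ _
      _ = _ := by rw [weightedDist_comm w T y' y]; ring
  induction l using List.reverseRecOn with
  | nil => exact absurd h hT
  | append_singleton l e ih =>
    obtain ⟨hl1, -, hl2⟩ := List.pairwise_append.mp hl
    rw [greedySpanner_append] at h h'
    rcases mem_edgeSet_greedyStep h with h | ⟨rfl, h⟩ <;>
      rcases mem_edgeSet_greedyStep h' with h' | ⟨he', h'⟩
    · exact ih hl1 h h'
    · have hle : w s(x, y) ≤ w s(x', y') := by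
        rcases mem_edgeSet_greedySpanner h with h0 | h0
        · exact absurd h0 hT
        · exact hl2 _ h0 _ (by simp [he'])
      rw [← he'] at h'
      have := direct l x' y' x y h' h
      calc (1 + ε) * (w s(x, y) : ℝ≥0∞) ≤ (1 + ε) * (w s(x', y') : ℝ≥0∞) := by gcongr
        _ ≤ _ := this
        _ ≤ _ := by
          rw [weightedDist_comm w T x' x, weightedDist_comm w T y' y]
          gcongr
    · exact direct l x y x' y' h h'
    · exact absurd he'.symm hne

theorem isSpanner_greedySpanner {G T : SimpleGraph V} {l : List (Sym2 V)} (hTG : T ≤ G)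
    (hl : ∀ e, e ∈ l ↔ e ∈ G.edgeSet ∧ e ∉ T.edgeSet) :
    IsSpanner w ε G (greedySpanner w ε T l) := by
  refine isSpanner_of_adj w ?_ fun x y hxy => ?_
  · rw [← SimpleGraph.edgeSet_subset_edgeSet]
    intro e he
    rcases mem_edgeSet_greedySpanner he with h | h
    · exact SimpleGraph.edgeSet_mono hTG h
    · exact ((hl e).mp h).1
  · by_cases hT : T.Adj x y
    · exact (weightedDist_le_of_adj w (le_greedySpanner T l hT)).trans
        (le_mul_of_one_le_left' le_self_add)
    · exact weightedDist_greedySpanner_le hxy.ne ((hl _).mpr ⟨hxy, hT⟩)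

end Greedy

/-! ### Sweeping a caterpillar decomposition -/

section Caterpillar

theorem SimpleGraph.Walk.IsPath.exists_subpath {ι : Type*} {S : SimpleGraph ι} {a b : ι}
    {p : S.Walk a b} (hp : p.IsPath) (i : ℕ) : ∀ j, i ≤ j → j ≤ p.length →
    ∃ q : S.Walk (p.getVert i) (p.getVert j), q.IsPath ∧
      ∀ x, x ∈ q.support ↔ ∃ m, i ≤ m ∧ m ≤ j ∧ x = p.getVert m := by
  intro j hij
  induction j, hij using Nat.le_induction with
  | base =>
    intro _
    refine ⟨.nil, .nil, fun x => ?_⟩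
    simp only [SimpleGraph.Walk.support_nil, List.mem_singleton]
    constructor
    · exact fun h => ⟨i, le_rfl, le_rfl, h⟩
    · rintro ⟨m, h1, h2, rfl⟩
      rw [le_antisymm h1 h2]
  | succ j hij ih =>
    intro hj
    obtain ⟨q, hq, hsup⟩ := ih (by omega)
    refine ⟨q.concat (p.adj_getVert_succ (by omega)), hq.concat ?_ _, fun x => ?_⟩
    · rw [hsup]
      rintro ⟨m, h1, h2, h3⟩
      have := hp.getVert_injOn (show j + 1 ∈ {i | i ≤ p.length} from hj)
        (show m ∈ {i | i ≤ p.length} by simp; omega) h3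
      omega
    · rw [SimpleGraph.Walk.support_concat, List.mem_append, List.mem_singleton,
        hsup]
      constructor
      · rintro (⟨m, h1, h2, rfl⟩ | rfl)
        · exact ⟨m, h1, by omega, rfl⟩
        · exact ⟨j + 1, by omega, le_rfl, rfl⟩
      · rintro ⟨m, h1, h2, rfl⟩
        rcases h2.eq_or_lt with rfl | h2
        · exact Or.inr rfl
        · exact Or.inl ⟨m, h1, by omega, rfl⟩

/-- In a tree with central path `p`, every walk between two different vertices hanging at positions
`i ≤ l` of the path passes through all positions between `i` and `l`. -/
theorem getVert_mem_support_of_isTree {ι : Type*} {S : SimpleGraph ι} (hS : S.IsTree) {a b : ι}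
    {p : S.Walk a b} (hp : p.IsPath) {x y : ι} {i m l : ℕ} (hne : x ≠ y)
    (hx : x = p.getVert i ∨ x ∉ p.support ∧ S.Adj x (p.getVert i))
    (hy : y = p.getVert l ∨ y ∉ p.support ∧ S.Adj y (p.getVert l))
    (him : i ≤ m) (hml : m ≤ l) (hl : l ≤ p.length) (r : S.Walk x y) :
    p.getVert m ∈ r.support := by
  classical
  obtain ⟨q, hq, hsup⟩ := hp.exists_subpath i l (him.trans hml) hl
  have hqp : ∀ z ∈ q.support, z ∈ p.support := by
    intro z hz
    obtain ⟨t, -, -, rfl⟩ := (hsup z).mp hz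
    exact p.getVert_mem_support t
  obtain ⟨q₁, hq₁, hm₁, hsup₁⟩ : ∃ q₁ : S.Walk x (p.getVert l), q₁.IsPath ∧
      p.getVert m ∈ q₁.support ∧ ∀ z ∈ q₁.support, z = x ∨ z ∈ p.support := by
    have hm : p.getVert m ∈ q.support := (hsup _).mpr ⟨m, him, hml, rfl⟩
    rcases hx with rfl | ⟨hxp, hadj⟩
    · exact ⟨q, hq, hm, fun z hz => Or.inr (hqp z hz)⟩
    · refine ⟨.cons hadj q, hq.cons fun h => hxp (hqp x h), by simp [hm], fun z hz => ?_⟩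
      rw [SimpleGraph.Walk.support_cons, List.mem_cons] at hz
      exact hz.imp id (hqp z)
  obtain ⟨q₂, hq₂, hm₂⟩ : ∃ q₂ : S.Walk x y, q₂.IsPath ∧ p.getVert m ∈ q₂.support := by
    rcases hy with rfl | ⟨hyp, hadj⟩
    · exact ⟨q₁, hq₁, hm₁⟩
    · refine ⟨q₁.concat hadj.symm, hq₁.concat (fun h => ?_) _, ?_⟩
      · rcases hsup₁ y h with h | h
        · exact hne h.symm
        · exact hyp h
      · rw [SimpleGraph.Walk.support_concat]
        simp [hm₁]
  have huniq : (⟨q₂, hq₂⟩ : S.Path x y) = ⟨r.bypass, r.bypass_isPath⟩ :=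
    (hS.isAcyclic.subsingleton_path x y).elim _ _
  have heq : q₂ = r.bypass := congrArg Subtype.val huniq
  rw [heq] at hm₂
  exact r.support_bypass_subset_support hm₂

/-- A caterpillar decomposition of width `k` yields a linear order of the vertices whose bags have
at most `2 * k + 2` vertices: sweep the bags along the central path, each one together with the
bag of the central path at which it hangs, and order the vertices by the last bag in which they
occur. -/
theorem HasCaterpillarDecomposition.exists_rank {V : Type*} [Finite V] {G : SimpleGraph V} {k : ℕ}
    (h : HasCaterpillarDecomposition G k) :
    ∃ R : V → ℕ, Function.Injective R ∧ ∀ u,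
      {v | R u ≤ R v ∧ ∃ z, R z ≤ R u ∧ (z = v ∨ G.Adj z v)}.ncard ≤ 2 * k + 2 := by
  obtain ⟨n, S, B, ⟨hS, a, b, p, hp, hcat⟩, hdec, hcard⟩ := h
  have hpos : ∀ i, ∃ t, t ≤ p.length ∧
      (i = p.getVert t ∨ i ∉ p.support ∧ S.Adj i (p.getVert t)) := by
    intro i
    by_cases hi : i ∈ p.support
    · obtain ⟨t, ht, hle⟩ := SimpleGraph.Walk.mem_support_iff_exists_getVert.mp hi
      exact ⟨t, hle, Or.inl ht.symm⟩
    · obtain ⟨j, hj, hadj⟩ := (hcat i).resolve_left hi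
      obtain ⟨t, rfl, hle⟩ := SimpleGraph.Walk.mem_support_iff_exists_getVert.mp hj
      exact ⟨t, hle, Or.inr ⟨hi, hadj⟩⟩
  choose s hsle hs using hpos
  let π : Fin n → ℕ := fun i => s i * n + i
  have hπs : ∀ i j, π i ≤ π j → s i ≤ s j := by
    intro i j hij
    by_contra hlt
    have h1 : (s j + 1) * n ≤ s i * n := Nat.mul_le_mul_right n (by omega)
    have h2 := j.isLt
    simp only [π] at hij
    rw [add_mul] at h1
    omega
  have hπinj : ∀ i j, π i = π j → i = j := by
    intro i j hij
    have h1 := le_antisymm (hπs i j hij.le) (hπs j i hij.ge)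
    simp only [π, h1] at hij
    exact Fin.ext (by omega)
  have hlast : ∀ v, ∃ i, v ∈ B i ∧ ∀ j, v ∈ B j → π j ≤ π i := by
    intro v
    obtain ⟨i, hi, hmax⟩ := Set.exists_max_image {i | v ∈ B i} π (Set.toFinite _)
      (hdec.vertex_mem v)
    exact ⟨i, hi, hmax⟩
  choose last hlast hlastmax using hlast
  obtain ⟨M, ⟨e⟩⟩ := Finite.exists_equiv_fin V
  let R : V → ℕ := fun v => π (last v) * M + e v
  have hR : ∀ u v, R u ≤ R v → π (last u) ≤ π (last v) := by
    intro u v huv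
    by_contra hlt
    have h1 : (π (last v) + 1) * M ≤ π (last u) * M := Nat.mul_le_mul_right M (by omega)
    have h2 := (e v).isLt
    simp only [R] at huv
    rw [add_mul] at h1
    omega
  refine ⟨R, fun u v huv => ?_, fun u => ?_⟩
  · have h1 := le_antisymm (hR u v huv.le) (hR v u huv.ge)
    simp only [R, h1] at huv
    exact e.injective (Fin.ext (by omega))
  · have hsub : {v | R u ≤ R v ∧ ∃ z, R z ≤ R u ∧ (z = v ∨ G.Adj z v)} ⊆
        (B (last u) : Set V) ∪ (B (p.getVert (s (last u))) : Set V) := by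
      rintro v ⟨huv, z, hzu, hz⟩
      obtain ⟨j, hj, hjπ⟩ : ∃ j, v ∈ B j ∧ π j ≤ π (last u) := by
        rcases hz with rfl | hz
        · exact ⟨last z, hlast z, hR _ _ hzu⟩
        · obtain ⟨j, hzj, hvj⟩ := hdec.edge_mem z v hz
          exact ⟨j, hvj, (hlastmax z j hzj).trans (hR _ _ hzu)⟩
      have huv' := hR _ _ huv
      by_cases hne : j = last v
      · left
        have : j = last u := hπinj _ _ (le_antisymm hjπ (hne ▸ huv'))
        exact this ▸ hj
      · right
        obtain ⟨q⟩ := hdec.connected v ⟨j, hj⟩ ⟨last v, hlast v⟩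
        have hq : ∀ x ∈ (q.map (SimpleGraph.Embedding.induce {i | v ∈ B i}).toHom).support,
            v ∈ B x := by
          intro x hx
          rw [SimpleGraph.Walk.support_map, List.mem_map] at hx
          obtain ⟨y, -, rfl⟩ := hx
          exact y.2
        exact hq _ (getVert_mem_support_of_isTree hS hp hne (hs j) (hs (last v))
          (hπs _ _ hjπ) (hπs _ _ huv') (hsle _) _)
    have h1 := Set.ncard_le_ncard hsub (Set.toFinite _)
    have h2 := Set.ncard_union_le (B (last u) : Set V) (B (p.getVert (s (last u))) : Set V)
    rw [Set.ncard_coe_finset, Set.ncard_coe_finset] at h2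
    have := hcard (last u)
    have := hcard (p.getVert (s (last u)))
    omega

theorem hasCaterpillarDecomposition_of_catwidth_le {V : Type*} [Fintype V] {G : SimpleGraph V}
    {k : ℕ} (h : catwidth G ≤ k) : HasCaterpillarDecomposition G k := by
  have hne : {k | HasCaterpillarDecomposition G k}.Nonempty := by
    have htree : (⊥ : SimpleGraph (Fin 1)).IsTree := SimpleGraph.IsTree.of_subsingleton
    refine ⟨Fintype.card V, 1, ⊥, fun _ => Finset.univ, ⟨htree, 0, 0, .nil, .nil, fun i => ?_⟩,
      ⟨htree, fun v => ⟨0, Finset.mem_univ v⟩,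
        fun u v _ => ⟨0, Finset.mem_univ u, Finset.mem_univ v⟩, fun v x y => ?_⟩, fun i => ?_⟩
    · exact Or.inl (by simp [Subsingleton.elim i 0])
    · rw [Subsingleton.elim x y]
    · simp
  obtain ⟨n, S, B, h1, h2, h3⟩ := Nat.sInf_mem hne
  exact ⟨n, S, B, h1, h2, fun i => (h3 i).trans (Nat.add_le_add_right h 1)⟩

end Caterpillar

/-! ### The weight of the greedy spanner -/

section Lightness

variable {V : Type*} [Fintype V]

/-- If the vertices can be swept with bags of at most `n + 1` vertices, the edges added by the
greedy algorithm to a connected spanning subgraph `T` weigh `O(n ^ 3 / ε)` times as much as `T`. -/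
theorem mul_sum_greedySpanner_sdiff_le [Nonempty V] [LinearOrder V] {G T : SimpleGraph V} (n : ℕ)
    (hn : ∀ u, (frontierAt G u).ncard ≤ n + 1) (hTG : T ≤ G) (hT : T.Connected)
    {w : Sym2 V → ℝ≥0} {l : List (Sym2 V)} (hl : IsGreedyOrder w G T l) (ε : ℝ≥0)
    (E : Finset (Sym2 V))
    (hE : ∀ e, e ∈ E ↔ e ∈ (greedySpanner w ε T l).edgeSet ∧ e ∉ T.edgeSet) :
    ε * ∑ e ∈ E, w e ≤ (4 * (n + 1) * (n * (n + 4)) + 1) * totalWeight w T := by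
  classical
  obtain ⟨b, S, hb, hS⟩ := exists_later_bagmate n T fun u =>
    (Set.ncard_le_ncard (fun v hv => frontierAt_mono hTG u hv.1) (Set.toFinite _)).trans (hn u)
  have hlater : ∀ v, ¬ IsMax v → HasLater T v := by
    intro v hv
    obtain ⟨x, hx⟩ := not_isMax_iff.mp hv
    exact ⟨x, hT.preconnected v x, hx⟩
  have htot : (totalWeight w T : ℝ≥0∞) = ∑ e ∈ T.edgeFinset, (w e : ℝ≥0∞) := by
    rw [totalWeight, ENNReal.ofNNReal_finsetSum]
  have hmoves : ∑ v with ¬ IsMax v, weightedDist w T v (b v) ≤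
      ((n * (n + 4) : ℕ) : ℝ≥0∞) * totalWeight w T := by
    calc ∑ v with ¬ IsMax v, weightedDist w T v (b v)
        ≤ ∑ v with ¬ IsMax v, ∑ e ∈ T.edgeFinset, if e ∈ S v then (w e : ℝ≥0∞) else 0 := by
          refine Finset.sum_le_sum fun v hv => ?_
          obtain ⟨-, -, h1, h2⟩ := hb v (hlater v (Finset.mem_filter.mp hv).2)
          rw [← Finset.sum_filter]
          refine weightedDist_le_sum w h1 _ (fun e he => ?_) h2
          simpa [he] using h1 he
      _ = ∑ e ∈ T.edgeFinset, ∑ v with ¬ IsMax v, if e ∈ S v then (w e : ℝ≥0∞) else 0 :=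
          Finset.sum_comm
      _ ≤ ∑ e ∈ T.edgeFinset, ((n * (n + 4) : ℕ) : ℝ≥0∞) * w e := by
          refine Finset.sum_le_sum fun e _ => ?_
          rw [← Finset.sum_filter, Finset.sum_const, nsmul_eq_mul]
          gcongr
          rw [← Set.ncard_coe_finset]
          refine (Set.ncard_le_ncard (fun v hv => ?_) (Set.toFinite _)).trans (hS e)
          simp only [Finset.coe_filter, Finset.mem_filter, Finset.mem_univ, true_and,
            Set.mem_ofPred_eq] at hv
          exact ⟨hlater v hv.1, hv.2⟩
      _ = _ := by rw [htot, Finset.mul_sum]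
  obtain ⟨L, hL, hcost⟩ := exists_tour_of_adj G (n + 1) hn b
    (fun v hv => by
      obtain ⟨h1, ⟨z, hz, hadj⟩, -⟩ := hb v (hlater v hv)
      exact ⟨h1, z, hz, hTG hadj⟩)
    (weightedDist w T) (weightedDist_self w T) (weightedDist_comm w T) _ hmoves
  -- the points of the tour that represent the edges of `E`, in the order of their first visit
  let Q : Finset (V × V) := E.image Quot.out
  have hout : ∀ e : Sym2 V, s((Quot.out e).1, (Quot.out e).2) = e := fun e => Quot.out_eq e
  let L' : List (V × V) := (L.filter fun x => x ∈ Q).dedup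
  have hL'Q : ∀ x, x ∈ L' ↔ x ∈ Q := by
    intro x
    simp only [L', List.mem_dedup, List.mem_filter, decide_eq_true_eq, and_iff_right_iff_imp]
    intro hx
    obtain ⟨e, he, rfl⟩ := Finset.mem_image.mp hx
    refine hL _ _ ?_
    have h1 := ((hE e).mp he).1
    have h2 := (isSpanner_greedySpanner (w := w) (ε := ε) hTG hl.2.1).1
    rw [← hout e] at h1
    exact h2 h1
  have hQE : ∀ x ∈ Q, s(x.1, x.2) ∈ (greedySpanner w ε T l).edgeSet ∧ s(x.1, x.2) ∉ T.edgeSet := by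
    intro x hx
    obtain ⟨e, he, rfl⟩ := Finset.mem_image.mp hx
    rw [hout]
    exact (hE e).mp he
  have hmain := sum_le_chainCost (W := fun x : V × V => (w s(x.1, x.2) : ℝ≥0∞))
    (D := fun p q => weightedDist w T p.1 q.1 + weightedDist w T p.2 q.2) (c := 1 + ε)
    (M := totalWeight w T) L' ?_ ?_
  · have hsum : (L'.map fun x : V × V => (w s(x.1, x.2) : ℝ≥0∞)).sum = ∑ e ∈ E, (w e : ℝ≥0∞) := by
      rw [← List.sum_toFinset _ (List.nodup_dedup _)]
      have : L'.toFinset = Q := by ext x; rw [List.mem_toFinset, hL'Q]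
      rw [this, Finset.sum_image fun e _ f _ hef => by rw [← hout e, hef, hout f]]
      exact Finset.sum_congr rfl fun e _ => by rw [hout]
    have htail : (L'.tail.map fun x : V × V => (w s(x.1, x.2) : ℝ≥0∞)).sum ≤
        ∑ e ∈ E, (w e : ℝ≥0∞) := by
      rw [← hsum]
      exact ((List.tail_sublist L').map _).sum_le_sum fun _ _ => zero_le
    have hsub : chainCost (fun p q : V × V => weightedDist w T p.1 q.1 + weightedDist w T p.2 q.2)
        L' ≤ 4 * (n + 1 : ℕ) * (((n * (n + 4) : ℕ) : ℝ≥0∞) * totalWeight w T) := by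
      refine (chainCost_le_of_sublist (fun x y z => ?_)
        ((List.dedup_sublist _).trans List.filter_sublist)).trans hcost
      calc _ ≤ (weightedDist w T x.1 y.1 + weightedDist w T y.1 z.1) +
            (weightedDist w T x.2 y.2 + weightedDist w T y.2 z.2) :=
          add_le_add (weightedDist_triangle w T _ _ _) (weightedDist_triangle w T _ _ _)
        _ = _ := by ring
    rw [hsum, ← ENNReal.ofNNReal_finsetSum] at hmain
    rw [← ENNReal.ofNNReal_finsetSum] at htail
    have h := hmain.trans (add_le_add (add_le_add htail hsub) le_rfl)
    rw [add_assoc, add_mul, one_mul, ENNReal.add_le_add_iff_left ENNReal.coe_ne_top] at h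
    have h' : ((ε * ∑ e ∈ E, w e : ℝ≥0) : ℝ≥0∞) ≤
        ((4 * (n + 1 : ℕ) * (((n * (n + 4) : ℕ) : ℝ≥0) * totalWeight w T) + totalWeight w T : ℝ≥0) :
          ℝ≥0∞) := by
      push_cast at h ⊢
      exact h
    refine (ENNReal.coe_le_coe.mp h').trans (le_of_eq ?_)
    push_cast
    ring
  · refine (List.nodup_dedup _).pairwise_of_forall_ne fun x hx y hy hxy => ?_
    have hxQ := (hL'Q x).mp hx
    have hyQ := (hL'Q y).mp hy
    refine mul_weight_le_detour hl.2.2 (hQE x hxQ).1 (hQE x hxQ).2 (hQE y hyQ).1 fun heq => hxy ?_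
    obtain ⟨e, -, rfl⟩ := Finset.mem_image.mp hxQ
    obtain ⟨f, -, rfl⟩ := Finset.mem_image.mp hyQ
    rw [hout, hout] at heq
    rw [heq]
  · intro x hx
    have hxQ := hQE x ((hL'Q x).mp hx)
    refine (mul_weight_le_weightedDist_of_mem_greedySpanner hxQ.1 hxQ.2).trans ?_
    rw [htot]
    refine weightedDist_le_sum w (S := T.edgeSet) le_rfl _ (by simp) ?_
    rw [SimpleGraph.fromEdgeSet_edgeSet]
    exact hT.preconnected _ _

theorem IsMinSpanningTree.totalWeight_le_mstWeight {w : Sym2 V → ℝ≥0} {G T : SimpleGraph V}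
    (hT : IsMinSpanningTree w G T) : totalWeight w T ≤ mstWeight w G := by
  refine le_csInf ⟨_, T, hT.1, rfl⟩ ?_
  rintro x ⟨T', hT', rfl⟩
  exact hT.2 T' hT'

theorem exists_isMinSpanningTree (w : Sym2 V → ℝ≥0) {G : SimpleGraph V} (hG : G.Connected) :
    ∃ T, IsMinSpanningTree w G T := by
  obtain ⟨T, hT⟩ := hG.exists_isTree_le
  obtain ⟨T, hT, hmin⟩ := Set.exists_min_image {T | IsSpanningTree G T} (totalWeight w)
    (Set.toFinite _) ⟨T, hT⟩
  exact ⟨T, hT, hmin⟩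

theorem exists_isGreedyOrder (w : Sym2 V → ℝ≥0) (G T : SimpleGraph V) :
    ∃ l, IsGreedyOrder w G T l := by
  classical
  let E : Finset (Sym2 V) := Finset.univ.filter fun e => e ∈ G.edgeSet ∧ e ∉ T.edgeSet
  have hperm := List.mergeSort_perm E.toList fun e f => decide (w e ≤ w f)
  refine ⟨E.toList.mergeSort fun e f => decide (w e ≤ w f), ?_, fun e => ?_, ?_⟩
  · exact hperm.nodup_iff.mpr E.nodup_toList
  · rw [hperm.mem_iff, Finset.mem_toList]
    simp [E]
  · refine (List.pairwise_mergeSort (fun a b c h1 h2 => ?_) (fun a b => ?_) E.toList).imp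
      fun h => by simpa using h
    · simp only [decide_eq_true_eq] at h1 h2 ⊢
      exact h1.trans h2
    · simpa using le_total (w a) (w b)

/-- The weight bound for any connected spanning subgraph `T`; minimality of `T` plays no role here.
The constant comes from bags of `2 * k + 2` vertices:
`4 (2k + 2) (2k + 1) (2k + 5) + 1 ≤ 4 · 4k · 3k · 7k + k³ = 337 k³` for `k ≥ 1`. -/
theorem totalWeight_greedySpanner_le {G T : SimpleGraph V} {k : ℕ} (hk : catwidth G ≤ k)
    {w : Sym2 V → ℝ≥0} {ε : ℝ≥0} (hε : 0 < ε) (hTG : T ≤ G) (hT : T.Connected)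
    {l : List (Sym2 V)} (hl : IsGreedyOrder w G T l) :
    totalWeight w (greedySpanner w ε T l) ≤
      337 * (k : ℝ≥0) ^ 2 * (1 + (k : ℝ≥0) / ε) * totalWeight w T := by
  classical
  have hdec := hasCaterpillarDecomposition_of_catwidth_le hk
  rcases Nat.eq_zero_or_pos k with rfl | hkpos
  · -- bags with at most one vertex contain no edge
    obtain ⟨n, S, B, -, hB, hcard⟩ := hdec
    have hbot : ∀ e, e ∉ (greedySpanner w ε T l).edgeSet := by
      intro e he
      have he' : e ∈ G.edgeSet :=
        SimpleGraph.edgeSet_mono (isSpanner_greedySpanner (w := w) (ε := ε) hTG hl.2.1).1 he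
      induction e with
      | _ x y =>
        obtain ⟨i, hx, hy⟩ := hB.edge_mem x y he'
        exact SimpleGraph.Adj.ne he' (Finset.card_le_one.mp (hcard i) x hx y hy)
    rw [totalWeight, Finset.sum_eq_zero fun e he => ?_]
    · exact zero_le
    · exact absurd (SimpleGraph.mem_edgeFinset.mp he) (hbot e)
  · obtain ⟨R, hR, hfront⟩ := hdec.exists_rank
    let : LinearOrder V := LinearOrder.lift' R hR
    have := hT.nonempty
    let E : Finset (Sym2 V) :=
      Finset.univ.filter fun e => e ∈ (greedySpanner w ε T l).edgeSet ∧ e ∉ T.edgeSet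
    have h1 := mul_sum_greedySpanner_sdiff_le (2 * k + 1) (fun u => hfront u) hTG hT hl ε E
      (fun e => by simp [E])
    have h2 : totalWeight w (greedySpanner w ε T l) ≤ totalWeight w T + ∑ e ∈ E, w e := by
      unfold totalWeight
      rw [← Finset.sum_union_inter]
      refine (Finset.sum_le_sum_of_subset fun e he => ?_).trans le_self_add
      rw [SimpleGraph.mem_edgeFinset] at he
      by_cases heT : e ∈ T.edgeSet
      · exact Finset.mem_union_left _ (SimpleGraph.mem_edgeFinset.mpr heT)
      · exact Finset.mem_union_right _ (by simp [E, he, heT])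
    have hc : ((4 * ((2 * k + 1 : ℕ) + 1) * ((2 * k + 1 : ℕ) * ((2 * k + 1 : ℕ) + 4)) + 1 : ℝ≥0)) ≤
        337 * (k : ℝ≥0) ^ 3 := by
      have h3 : 4 * (2 * k + 1 + 1) * ((2 * k + 1) * (2 * k + 1 + 4)) + 1 ≤ 337 * k ^ 3 := by
        calc 4 * (2 * k + 1 + 1) * ((2 * k + 1) * (2 * k + 1 + 4)) + 1
            ≤ 4 * (4 * k) * ((3 * k) * (7 * k)) + k ^ 3 := by
              gcongr
              · omega
              · omega
              · omega
              · exact Nat.one_le_pow _ _ hkpos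
          _ = 337 * k ^ 3 := by ring
      exact_mod_cast h3
    have hk1 : (1 : ℝ≥0) ≤ (k : ℝ≥0) ^ 2 := one_le_pow₀ (by exact_mod_cast hkpos)
    have h4 : ∑ e ∈ E, w e ≤ 337 * (k : ℝ≥0) ^ 3 * totalWeight w T / ε := by
      rw [le_div_iff₀ hε, mul_comm]
      exact h1.trans (mul_le_mul_left hc _)
    calc totalWeight w (greedySpanner w ε T l)
        ≤ 1 * totalWeight w T + 337 * (k : ℝ≥0) ^ 3 * totalWeight w T / ε := by
          rw [one_mul]
          exact h2.trans (add_le_add le_rfl h4)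
      _ ≤ 337 * (k : ℝ≥0) ^ 2 * totalWeight w T +
            337 * (k : ℝ≥0) ^ 3 * totalWeight w T / ε := by
          gcongr
          exact one_le_mul (by norm_num) hk1
      _ = _ := by
          field_simp

end Lightness

theorem theorem1 :
    ∃ C : ℝ≥0, ∀ (V : Type u) [Fintype V] (G : SimpleGraph V) (k : ℕ) (w : Sym2 V → ℝ≥0)
      (ε : ℝ≥0), G.Connected → catwidth G ≤ k → 0 < ε →
      (∃ H : SimpleGraph V, IsSpanner w ε G H ∧
        totalWeight w H ≤ C * (k : ℝ≥0) ^ 2 * (1 + (k : ℝ≥0) / ε) * mstWeight w G) ∧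
      ∀ (T : SimpleGraph V) (l : List (Sym2 V)),
        IsMinSpanningTree w G T → IsGreedyOrder w G T l →
        IsSpanner w ε G (greedySpanner w ε T l) ∧
        totalWeight w (greedySpanner w ε T l) ≤
          C * (k : ℝ≥0) ^ 2 * (1 + (k : ℝ≥0) / ε) * mstWeight w G := by
  refine ⟨337, fun V _ G k w ε hG hk hε => ?_⟩
  have hgreedy : ∀ (T : SimpleGraph V) (l : List (Sym2 V)),
      IsMinSpanningTree w G T → IsGreedyOrder w G T l →
      IsSpanner w ε G (greedySpanner w ε T l) ∧
      totalWeight w (greedySpanner w ε T l) ≤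
        337 * (k : ℝ≥0) ^ 2 * (1 + (k : ℝ≥0) / ε) * mstWeight w G := by
    intro T l hT hl
    refine ⟨isSpanner_greedySpanner hT.1.1 hl.2.1, ?_⟩
    refine (totalWeight_greedySpanner_le hk hε hT.1.1 hT.1.2.connected hl).trans ?_
    gcongr
    exact hT.totalWeight_le_mstWeight
  obtain ⟨T, hT⟩ := exists_isMinSpanningTree w hG
  obtain ⟨l, hl⟩ := exists_isGreedyOrder w G T
  exact ⟨⟨_, hgreedy T l hT hl⟩, hgreedy⟩
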